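/- Corollary 4.3. Let $\mathcal U=\{z\in\mathbb C:|z|\le 1\}$. A Leja sequence on $\mathcal U$ initiated at $1$ is a sequence $E=(e_j)_{j\ge 0}$ in $\mathcal U$ with $e_0=1$ such that, for every $k\ge 1$, the point $e_k$ maximizes $z\mapsto |z-e_{k-1}|\cdots|z-e_0|$ over $\mathcal U$. The $\Re$-Leja sequence $R=(r_k)_{k\ge 0}$ in $[-1,1]$ associated with $E$ is given by $r_k=\Re(e_{J(k)})$, where $J(0)=0$ and $J(k)=\min\{j>J(k-1): \Re(e_j)\notin\{r_0,\dots,r_{k-1}\}\}$ for $k\ge 1$. For $k\ge 1$ let $I_{R_k}$ be the Lagrange interpolation operator at the points $r_0,\dots,r_{k-1}$, acting on the space $C([-1,1])$ of continuous (real- or complex-valued) functions with the supremum norm. Let $\Delta_0=I_{R_1}$ and $\Delta_k=I_{R_{k+1}}-I_{R_k}$ for $k\ge 1$, and let $$\mathbb D_k(R)=\max_{f\in C([-1,1])\setminus\{0\}}\frac{\|\Delta_k f\|_\infty}{\|f\|_\infty}$$ be the operator norm of $\Delta_k$. Let $\sigma_1(k)$ be the number of ones in the binary expansion of $k$. Then,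 for every $\Re$-Leja sequence $R$ in $[-1,1]$ (that is, one associated with some Leja sequence on $\mathcal U$ initiated at $1$), $\mathbb D_0(R)=1$ and, for all integers $n\ge 0$ and $k$ with $2^n\le k<2^{n+1}$, $$\mathbb D_k(R)\le 2^{\sigma_1(k)}\,2^n .$$ -/

import Mathlib

/-- `E` is a Leja sequence on the closed complex unit disc initiated at `1`: `E 0 = 1` and, for
every `k ≥ 1`, `E k` maximizes `z ↦ |z - E (k-1)| ⋯ |z - E 0|` over the closed unit disc. -/
def IsLejaFromOne (E : ℕ → ℂ) : Prop :=
  E 0 = 1 ∧ ∀ k : ℕ, 1 ≤ k → E k ∈ Metric.closedBall (0 : ℂ) 1 ∧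
    IsMaxOn (fun z : ℂ => ∏ j ∈ Finset.range k, ‖z - E j‖) (Metric.closedBall (0 : ℂ) 1) (E k)

/-- `R` is the `ℜ`-Leja sequence associated with `E`: `R k = Re (E (J k))` where `J 0 = 0` and, for
`k ≥ 1`, `J k` is the least `j > J (k-1)` with `Re (E j) ∉ {R 0, …, R (k-1)}`. -/
def IsRealProjectionOf (R : ℕ → Set.Icc (-1 : ℝ) 1) (E : ℕ → ℂ) : Prop :=
  ∃ J : ℕ → ℕ, J 0 = 0 ∧
    (∀ k : ℕ, 1 ≤ k →
      IsLeast {j : ℕ | J (k - 1) < j ∧ ∀ i < k, (E j).re ≠ (R i : ℝ)} (J k)) ∧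
    ∀ k : ℕ, (R k : ℝ) = (E (J k)).re

/-- An `ℜ`-Leja sequence in `[-1, 1]`: the projection, element-wise and without repetition, of a
Leja sequence on the unit disc initiated at `1`. -/
def IsRLeja (R : ℕ → Set.Icc (-1 : ℝ) 1) : Prop :=
  ∃ E : ℕ → ℂ, IsLejaFromOne E ∧ IsRealProjectionOf R E

/-- The Lagrange polynomial `l_{j,k}` of the nodes `Z 0, …, Z (k-1)`, as a continuous `𝕜`-valued
function on `[-1, 1]`. -/
noncomputable def lagrangeFun (𝕜 : Type*) [RCLike 𝕜] (Z : ℕ → Set.Icc (-1 : ℝ) 1) (k j : ℕ) :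
    C(Set.Icc (-1 : ℝ) 1, 𝕜) where
  toFun x := (((Lagrange.basis (Finset.range k) (fun i => (Z i : ℝ)) j).eval (x : ℝ) : ℝ) : 𝕜)
  continuous_toFun := by fun_prop

/-- The interpolation operator `I_{Z_k} f = ∑_{j < k} f (Z j) l_{j,k}` of the section
`Z_k = (Z 0, …, Z (k-1))`, on `C([-1, 1])` with the sup norm. It is `0` for the empty section. -/
noncomputable def interpOp (𝕜 : Type*) [RCLike 𝕜] (Z : ℕ → Set.Icc (-1 : ℝ) 1) (k : ℕ) :
    C(Set.Icc (-1 : ℝ) 1, 𝕜) →L[𝕜] C(Set.Icc (-1 : ℝ) 1, 𝕜) :=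
  ∑ j ∈ Finset.range k,
    (ContinuousMap.evalCLM 𝕜 (Z j)).smulRight (lagrangeFun 𝕜 Z k j)

/-- The difference operator `Δ_k = I_{Z_{k+1}} - I_{Z_k}`; in particular `Δ_0 = I_{Z_1}`. -/
noncomputable def diffOp (𝕜 : Type*) [RCLike 𝕜] (Z : ℕ → Set.Icc (-1 : ℝ) 1) (k : ℕ) :
    C(Set.Icc (-1 : ℝ) 1, 𝕜) →L[𝕜] C(Set.Icc (-1 : ℝ) 1, 𝕜) :=
  interpOp 𝕜 Z (k + 1) - interpOp 𝕜 Z k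

/-- `𝔻_k(Z)`: the operator norm of `Δ_k` for the sup norm on `C([-1, 1])`. -/
noncomputable def diffNorm (𝕜 : Type*) [RCLike 𝕜] (Z : ℕ → Set.Icc (-1 : ℝ) 1) (k : ℕ) : ℝ :=
  ‖diffOp 𝕜 Z k‖

/-- `σ₁(k)`: the number of ones in the binary expansion of `k`. -/
def binaryOnes (k : ℕ) : ℕ := (Nat.digits 2 k).count 1

open Finset ComplexConjugate

/-! ### Binary digit sums -/

/-! A Leja sequence initiated at `1` lies on the unit circle, satisfies `E (2j+1) = -E (2j)`, and
the squares of its even terms again form a Leja sequence. `BinarySym` records this symmetry. Through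
`|z-w||z+w| = |z²-w²|`, quantities attached to `m` nodes reduce to ones attached to about `m/2`
nodes, one binary digit at a time; this is the source of the factors `2^σ₁`.

Let `w_k` be the nodal polynomial of `r_0, …, r_{k-1}`. Subtracting Lagrange bases gives `𝔻_k ≤
max_x |w_k(x)| ∑_j 1/|w_{k+1}'(r_j)|`. For `z`, `w` on the circle, `2|Re z - Re w| = |z-w||z̄-w|`,
so both factors become products of chords. The kept points are `1`, `-1` and the first half of each
block of `E` from `2^(n+1)` to `2^(n+2)`, since the second half repeats its conjugates. The first
`2^n+1` kept points and their conjugates are thus the `2^(n+1)`-th roots of unity.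

For `k = 2^n+1+m` with `m < 2^n`, the nodal factor is at most `4·2^(σ₁(m)+σ₁(m+1))`
(`nodeProd_mul_conj_le`) and the sum at most `2^n/(2·2^σ₁(m))` (`sum_chordDeriv_inv_le`). The terms
`2^σ₁(m)` cancel, leaving `2·2^σ₁(m+1)·2^n`, while `k = 2^n+(m+1)`. In the sum, the old nodes (via
the exact `BinarySym.sum_inv_sq_nodeProd`) and the nodes of the current block (via
`BinarySym.conjWeight_le`) each account for half of the bound. -/

theorem binaryOnes_zero : binaryOnes 0 = 0 := by simp [binaryOnes]

theorem binaryOnes_two_mul (k : ℕ) : binaryOnes (2 * k) = binaryOnes k := by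
  rcases Nat.eq_zero_or_pos k with rfl | hk
  · simp
  · have := Nat.digits_base_mul (b := 2) (by norm_num) hk
    simp [binaryOnes, this]

theorem binaryOnes_two_mul_add_one (k : ℕ) : binaryOnes (2 * k + 1) = binaryOnes k + 1 := by
  have := Nat.digits_add_two_add_one 0 (2 * k)
  simp only [zero_add] at this
  unfold binaryOnes
  rw [this]
  have h1 : (2 * k + 1) % 2 = 1 := by omega
  have h2 : (2 * k + 1) / 2 = k := by omega
  rw [h1, h2]
  simp

theorem binaryOnes_two_pow_add (n : ℕ) :
    ∀ l < 2 ^ n, binaryOnes (2 ^ n + l) = binaryOnes l + 1 := by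
  induction n with
  | zero =>
    intro l hl
    obtain rfl : l = 0 := by simpa using hl
    simpa using binaryOnes_two_mul_add_one 0
  | succ n ih =>
    intro l hl
    rw [pow_succ] at hl ⊢
    obtain ⟨l', rfl | rfl⟩ := Nat.even_or_odd' l
    · rw [show 2 ^ n * 2 + 2 * l' = 2 * (2 ^ n + l') by ring, binaryOnes_two_mul,
        binaryOnes_two_mul, ih l' (by omega)]
    · rw [show 2 ^ n * 2 + (2 * l' + 1) = 2 * (2 ^ n + l') + 1 by ring,
        binaryOnes_two_mul_add_one, binaryOnes_two_mul_add_one, ih l' (by omega)]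

/-! ### Sequences with the binary symmetry of Leja sequences -/

/-- Squares of the even-indexed terms of a sequence. -/
def evenSq (g : ℕ → ℂ) : ℕ → ℂ := fun j => g (2 * j) ^ 2

/-- `g (2j+1) = -g (2j)` for all `j`, and this persists through `n` successive applications
of `evenSq`. -/
def BinarySym : ℕ → (ℕ → ℂ) → Prop
  | 0, _ => True
  | n + 1, g => (∀ j, g (2 * j + 1) = -g (2 * j)) ∧ BinarySym n (evenSq g)

theorem prod_range_two_mul {M : Type*} [CommMonoid M] (f : ℕ → M) (n : ℕ) :
    ∏ i ∈ range (2 * n), f i = ∏ i ∈ range n, (f (2 * i) * f (2 * i + 1)) := by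
  induction n with
  | zero => simp
  | succ n ih =>
    rw [show 2 * (n + 1) = 2 * n + 1 + 1 by ring, prod_range_succ, prod_range_succ, ih,
      prod_range_succ, mul_assoc]

theorem sum_range_two_mul {M : Type*} [AddCommMonoid M] (f : ℕ → M) (n : ℕ) :
    ∑ i ∈ range (2 * n), f i = ∑ i ∈ range n, (f (2 * i) + f (2 * i + 1)) := by
  induction n with
  | zero => simp
  | succ n ih =>
    rw [show 2 * (n + 1) = 2 * n + 1 + 1 by ring, sum_range_succ, sum_range_succ, ih,
      sum_range_succ, add_assoc]

theorem norm_evenSq {g : ℕ → ℂ} (hg : ∀ j, ‖g j‖ = 1) (j : ℕ) : ‖evenSq g j‖ = 1 := by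
  simp [evenSq, hg]

/-- The modulus of the nodal polynomial of `g 0, …, g (m-1)`. -/
noncomputable def nodeProd (g : ℕ → ℂ) (m : ℕ) (z : ℂ) : ℝ := ∏ i ∈ range m, ‖z - g i‖

/-- The modulus of the derivative at `g j` of the nodal polynomial of `g 0, …, g (m-1)`. -/
noncomputable def nodeDeriv (g : ℕ → ℂ) (m j : ℕ) : ℝ :=
  ∏ i ∈ range m, if i = j then 1 else ‖g j - g i‖

theorem nodeProd_nonneg (g : ℕ → ℂ) (m : ℕ) (z : ℂ) : 0 ≤ nodeProd g m z :=
  prod_nonneg fun _ _ => norm_nonneg _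

theorem nodeProd_succ (g : ℕ → ℂ) (m : ℕ) (z : ℂ) :
    nodeProd g (m + 1) z = nodeProd g m z * ‖z - g m‖ := prod_range_succ _ _

theorem nodeDeriv_nonneg (g : ℕ → ℂ) (m j : ℕ) : 0 ≤ nodeDeriv g m j :=
  prod_nonneg fun _ _ => by split_ifs <;> simp

theorem nodeDeriv_succ_self (g : ℕ → ℂ) (m : ℕ) : nodeDeriv g (m + 1) m = nodeProd g m (g m) := by
  unfold nodeDeriv nodeProd
  rw [prod_range_succ, if_pos rfl, mul_one]
  exact prod_congr rfl fun i hi => if_neg (by simp at hi; omega)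

theorem nodeDeriv_succ_of_lt (g : ℕ → ℂ) {m j : ℕ} (h : j < m) :
    nodeDeriv g (m + 1) j = nodeDeriv g m j * ‖g j - g m‖ := by
  unfold nodeDeriv
  rw [prod_range_succ, if_neg (by omega)]

theorem norm_sub_mul_norm_add (z w : ℂ) : ‖z - w‖ * ‖z + w‖ = ‖z ^ 2 - w ^ 2‖ := by
  rw [← norm_mul]; ring_nf

theorem nodeProd_two_mul_of_lt {g : ℕ → ℂ} {m : ℕ} (h : ∀ j < m, g (2 * j + 1) = -g (2 * j))
    (z : ℂ) : nodeProd g (2 * m) z = nodeProd (evenSq g) m (z ^ 2) := by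
  unfold nodeProd
  rw [prod_range_two_mul]
  refine prod_congr rfl fun i hi => ?_
  rw [h i (mem_range.1 hi), sub_neg_eq_add, norm_sub_mul_norm_add]; rfl

theorem nodeProd_two_mul {g : ℕ → ℂ} (h : ∀ j, g (2 * j + 1) = -g (2 * j)) (m : ℕ) (z : ℂ) :
    nodeProd g (2 * m) z = nodeProd (evenSq g) m (z ^ 2) :=
  nodeProd_two_mul_of_lt (fun j _ => h j) z

theorem nodeDeriv_two_mul {g : ℕ → ℂ} (hg : ∀ j, ‖g j‖ = 1)
    (h : ∀ j, g (2 * j + 1) = -g (2 * j)) {m j : ℕ} (hj : j < m) :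
    nodeDeriv g (2 * m) (2 * j) = 2 * nodeDeriv (evenSq g) m j ∧
      nodeDeriv g (2 * m) (2 * j + 1) = 2 * nodeDeriv (evenSq g) m j := by
  have key : 2 * nodeDeriv (evenSq g) m j =
      ∏ i ∈ range m, if i = j then 2 else ‖evenSq g j - evenSq g i‖ := by
    have hm : j ∈ range m := mem_range.2 hj
    unfold nodeDeriv
    rw [← mul_prod_erase _ _ hm, ← mul_prod_erase _ _ hm, if_pos rfl, if_pos rfl, one_mul]
    congr 1
    refine prod_congr rfl fun i hi => ?_
    rw [if_neg (ne_of_mem_erase hi), if_neg (ne_of_mem_erase hi)]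
  have h2 : ‖g (2 * j) + g (2 * j)‖ = 2 := by
    rw [← two_mul, norm_mul, hg]; norm_num
  rw [key]
  unfold nodeDeriv
  constructor
  all_goals
    rw [prod_range_two_mul]
    refine prod_congr rfl fun i _ => ?_
    by_cases hij : i = j
    · subst hij
      simp [h]
      first
      | exact h2
      | rw [← h2, ← norm_neg]; ring_nf
    · rw [if_neg (by omega), if_neg (by omega), if_neg hij]
      simp only [evenSq, h]
      rw [← norm_sub_mul_norm_add]
      rw [sub_neg_eq_add]
      try rw [mul_comm, neg_add_eq_sub, norm_sub_rev, ← neg_add', norm_neg]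

namespace BinarySym

theorem of_succ (n : ℕ) : ∀ {g : ℕ → ℂ}, BinarySym (n + 1) g → BinarySym n g := by
  induction n with
  | zero => intro g _; trivial
  | succ n ih => intro g h; exact ⟨h.1, ih h.2⟩

theorem shift (n : ℕ) (a : ℕ) :
    ∀ {g : ℕ → ℂ}, BinarySym n g → BinarySym n fun j => g (2 ^ n * a + j) := by
  induction n with
  | zero => intro g _; trivial
  | succ n ih =>
    intro g h
    refine ⟨fun j => ?_, ?_⟩
    · beta_reduce
      rw [show 2 ^ (n + 1) * a + (2 * j + 1) = 2 * (2 ^ n * a + j) + 1 by ring, h.1]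
      congr 2; ring
    · convert ih h.2 using 1
      funext j
      simp only [evenSq]
      congr 2; ring

theorem conj_seq (n : ℕ) : ∀ {g : ℕ → ℂ}, BinarySym n g → BinarySym n fun j => conj (g j) := by
  induction n with
  | zero => intro g _; trivial
  | succ n ih =>
    intro g h
    refine ⟨fun j => by simp [h.1 j], ?_⟩
    convert ih h.2 using 1
    funext j
    simp [evenSq]

theorem pow_eq (n : ℕ) :
    ∀ {g : ℕ → ℂ}, BinarySym n g → ∀ i < 2 ^ n, g i ^ 2 ^ n = g 0 ^ 2 ^ n := by
  induction n with
  | zero => intro g _ i hi; obtain rfl : i = 0 := by simpa using hi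
            rfl
  | succ n ih =>
    intro g h i hi
    rw [pow_succ] at hi
    have e : ∀ z : ℂ, z ^ 2 ^ (n + 1) = (z ^ 2) ^ 2 ^ n := fun z => by
      rw [← pow_mul, pow_succ']
    rw [e, e]
    obtain ⟨j, rfl | rfl⟩ := Nat.even_or_odd' i
    · exact ih h.2 j (by omega)
    · rw [h.1, neg_sq]
      exact ih h.2 j (by omega)

theorem pow_odd (n : ℕ) :
    ∀ {g : ℕ → ℂ}, BinarySym (n + 1) g → ∀ a,
      g (2 ^ n * (2 * a + 1)) ^ 2 ^ n = -g (2 ^ n * (2 * a)) ^ 2 ^ n := by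
  induction n with
  | zero => intro g h a; simpa using h.1 a
  | succ n ih =>
    intro g h a
    have := ih h.2 a
    simp only [evenSq] at this
    rw [← pow_mul, ← pow_mul, ← pow_succ', ← mul_assoc, ← mul_assoc, ← pow_succ'] at this
    exact this

theorem injOn (n : ℕ) : ∀ {g : ℕ → ℂ}, (∀ j, ‖g j‖ = 1) → BinarySym n g →
    ∀ i < 2 ^ n, ∀ j < 2 ^ n, g i = g j → i = j := by
  induction n with
  | zero => intro g _ _ i hi j hj _; simp at hi hj; omega
  | succ n ih =>
    intro g hg h i hi j hj hij
    rw [pow_succ] at hi hj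
    have h0 : ∀ a, g a ≠ -g a := fun a ha => by
      have := hg a
      rw [self_eq_neg.1 ha] at this
      simp at this
    obtain ⟨a, rfl | rfl⟩ := Nat.even_or_odd' i <;> obtain ⟨b, rfl | rfl⟩ := Nat.even_or_odd' j
    all_goals
      have hab : a = b := ih (norm_evenSq hg) h.2 a (by omega) b (by omega) (by
        have e := congrArg (· ^ 2) hij
        simpa only [evenSq, h.1, neg_sq] using e)
      subst hab
    · rfl
    · rw [h.1] at hij; exact absurd hij (h0 _)
    · rw [h.1] at hij; exact absurd hij.symm (h0 _)
    · rfl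

theorem exists_of_pow_eq (n : ℕ) : ∀ {g : ℕ → ℂ}, BinarySym n g →
    ∀ z : ℂ, z ^ 2 ^ n = g 0 ^ 2 ^ n → ∃ i < 2 ^ n, g i = z := by
  induction n with
  | zero => intro g _ z hz; exact ⟨0, by simp, by simpa using hz.symm⟩
  | succ n ih =>
    intro g h z hz
    obtain ⟨i, hi, hiz⟩ := ih h.2 (z ^ 2) (by
      rw [pow_succ', pow_mul, pow_mul] at hz; exact hz)
    rcases sq_eq_sq_iff_eq_or_eq_neg.1 hiz with h1 | h1
    · exact ⟨2 * i, by rw [pow_succ]; omega, h1⟩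
    · exact ⟨2 * i + 1, by rw [pow_succ]; omega, by rw [h.1, h1, neg_neg]⟩

theorem nodeProd_two_pow (n : ℕ) : ∀ {g : ℕ → ℂ}, BinarySym n g → ∀ z : ℂ,
    nodeProd g (2 ^ n) z = ‖z ^ 2 ^ n - g 0 ^ 2 ^ n‖ := by
  induction n with
  | zero => intro g _ z; simp [nodeProd]
  | succ n ih =>
    intro g h z
    rw [pow_succ', nodeProd_two_mul h.1, ih h.2, pow_mul, pow_mul]; rfl

theorem nodeDeriv_two_pow (n : ℕ) : ∀ {g : ℕ → ℂ}, (∀ j, ‖g j‖ = 1) → BinarySym n g →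
    ∀ j < 2 ^ n, nodeDeriv g (2 ^ n) j = 2 ^ n := by
  induction n with
  | zero => intro g _ _ j hj; obtain rfl : j = 0 := by simpa using hj
            simp [nodeDeriv]
  | succ n ih =>
    intro g hg h j hj
    rw [pow_succ'] at hj ⊢
    obtain ⟨a, rfl | rfl⟩ := Nat.even_or_odd' j
    · rw [(nodeDeriv_two_mul hg h.1 (by omega)).1, ih (norm_evenSq hg) h.2 a (by omega), pow_succ']
    · rw [(nodeDeriv_two_mul hg h.1 (by omega)).2, ih (norm_evenSq hg) h.2 a (by omega), pow_succ']

/-- Both sequences enumerate, without repetition, the roots of the same equation `w^(2^n) = const`.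
-/
theorem sum_eq_sum_of_pow_eq {n : ℕ} {g h : ℕ → ℂ} (hg : ∀ j, ‖g j‖ = 1) (hh : ∀ j, ‖h j‖ = 1)
    (Hg : BinarySym n g) (Hh : BinarySym n h) (h0 : g 0 ^ 2 ^ n = h 0 ^ 2 ^ n) (φ : ℂ → ℝ) :
    ∑ i ∈ range (2 ^ n), φ (g i) = ∑ i ∈ range (2 ^ n), φ (h i) := by
  have aux : ∀ {g : ℕ → ℂ}, (∀ j, ‖g j‖ = 1) → BinarySym n g →
      ∑ i ∈ range (2 ^ n), φ (g i) = ∑ z ∈ (range (2 ^ n)).image g, φ z := by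
    intro g hg Hg
    rw [sum_image fun i hi j hj hij =>
      injOn n hg Hg i (by simpa using hi) j (by simpa using hj) hij]
  have sub : ∀ {g h : ℕ → ℂ}, BinarySym n g → BinarySym n h → g 0 ^ 2 ^ n = h 0 ^ 2 ^ n →
      (range (2 ^ n)).image g ⊆ (range (2 ^ n)).image h := by
    intro g h Hg Hh h0 z hz
    obtain ⟨i, hi, rfl⟩ := mem_image.1 hz
    obtain ⟨j, hj, hji⟩ := exists_of_pow_eq n Hh (g i)
      (by rw [pow_eq n Hg i (by simpa using hi), h0])
    exact mem_image.2 ⟨j, by simpa using hj, hji⟩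
  rw [aux hg Hg, aux hh Hh, (sub Hg Hh h0).antisymm (sub Hh Hg h0.symm)]

/-- Halving `m` costs nothing when `m` is even; when `m` is odd, the unpaired last node costs a
chord, at most `2`. -/
theorem nodeProd_le (n : ℕ) : ∀ {g : ℕ → ℂ}, (∀ j, ‖g j‖ = 1) → BinarySym n g →
    ∀ m ≤ 2 ^ n, ∀ z : ℂ, ‖z‖ = 1 → nodeProd g m z ≤ 2 ^ binaryOnes m := by
  have h2 : ∀ z w : ℂ, ‖z‖ = 1 → ‖w‖ = 1 → ‖z - w‖ ≤ 2 := fun z w hz hw =>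
    (norm_sub_le z w).trans (by rw [hz, hw]; norm_num)
  induction n with
  | zero =>
    intro g hg _ m hm z hz
    obtain rfl | rfl : m = 0 ∨ m = 1 := by simp at hm; omega
    · simp [nodeProd, binaryOnes_zero]
    · have : binaryOnes 1 = 1 := by simpa [binaryOnes_zero] using binaryOnes_two_mul_add_one 0
      simpa [nodeProd, this] using h2 z (g 0) hz (hg 0)
  | succ n ih =>
    intro g hg h m hm z hz
    rw [pow_succ] at hm
    have hz2 : ‖z ^ 2‖ = 1 := by simp [hz]
    obtain ⟨a, rfl | rfl⟩ := Nat.even_or_odd' m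
    · rw [nodeProd_two_mul h.1, binaryOnes_two_mul]
      exact ih (norm_evenSq hg) h.2 a (by omega) _ hz2
    · rw [nodeProd_succ, nodeProd_two_mul h.1, binaryOnes_two_mul_add_one, pow_succ]
      exact mul_le_mul (ih (norm_evenSq hg) h.2 a (by omega) _ hz2) (h2 _ _ hz (hg _))
        (norm_nonneg _) (pow_nonneg zero_le_two _)

end BinarySym

/-! ### Sums of reciprocals of nodal products -/

theorem inv_sq_norm_sub_add_inv_sq_norm_add {z w : ℂ} (hz : ‖z‖ = 1) (hw : ‖w‖ = 1)
    (h : z ^ 2 ≠ w ^ 2) :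
    ‖z - w‖⁻¹ ^ 2 + ‖z + w‖⁻¹ ^ 2 = 4 * ‖z ^ 2 - w ^ 2‖⁻¹ ^ 2 := by
  have hp : ‖z + w‖ ^ 2 + ‖z - w‖ ^ 2 = 4 := by
    have := parallelogram_law_with_norm ℝ z w
    rw [hz, hw] at this
    nlinarith
  have hne : ‖z - w‖ * ‖z + w‖ ≠ 0 := by
    rw [norm_sub_mul_norm_add]; exact norm_ne_zero_iff.2 (sub_ne_zero.2 h)
  have h1 := left_ne_zero_of_mul hne
  have h2 := right_ne_zero_of_mul hne
  rw [← norm_sub_mul_norm_add]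
  field_simp
  linarith

/-- Exact because summing over the pair `±z` turns an unpaired factor `|z-w|⁻²` into `4|z²-w²|⁻²`,
while a fully paired product takes the same value at `z` and `-z`. The opposite `2^n`-th powers keep
the evaluation points away from the nodes. -/
theorem BinarySym.sum_inv_sq_nodeProd (n : ℕ) : ∀ {x g : ℕ → ℂ}, (∀ j, ‖x j‖ = 1) →
    (∀ j, ‖g j‖ = 1) → BinarySym n x → BinarySym n g → x 0 ^ 2 ^ n = -g 0 ^ 2 ^ n →
    ∀ m < 2 ^ n, ∑ i ∈ range (2 ^ n), (nodeProd g (m + 1) (x i))⁻¹ ^ 2 =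
      4 ^ n / (4 * 2 ^ binaryOnes m) := by
  induction n with
  | zero =>
    intro x g hx hg _ _ h0 m hm
    obtain rfl : m = 0 := by simpa using hm
    simp only [pow_zero, pow_one] at h0
    have : ‖x 0 - g 0‖ = 2 := by
      rw [h0, ← neg_add', norm_neg, ← two_mul, norm_mul, hg]; norm_num
    simp [nodeProd, this, binaryOnes_zero]
    norm_num
  | succ n ih =>
    intro x g hx hg Hx Hg h0 m hm
    have hne : ∀ i < 2 ^ n, ∀ j < 2 ^ n, x (2 * i) ^ 2 ≠ g (2 * j) ^ 2 := by
      intro i hi j hj hij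
      have e := congrArg (· ^ 2 ^ n) hij
      simp only [← pow_mul, ← pow_succ'] at e
      rw [BinarySym.pow_eq _ Hx _ (by rw [pow_succ]; omega),
        BinarySym.pow_eq _ Hg _ (by rw [pow_succ]; omega), h0] at e
      have := hg 0
      rw [show g 0 = 0 by simpa using neg_eq_self.1 e] at this
      simp at this
    have h0' : evenSq x 0 ^ 2 ^ n = -evenSq g 0 ^ 2 ^ n := by
      simp only [evenSq, ← pow_mul, ← pow_succ']
      exact h0
    rw [pow_succ'] at hm ⊢
    rw [sum_range_two_mul]
    obtain ⟨a, rfl | rfl⟩ := Nat.even_or_odd' m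
    · have key := ih (norm_evenSq hx) (norm_evenSq hg) Hx.2 Hg.2 h0' a (by omega)
      rw [binaryOnes_two_mul, pow_succ (4 : ℝ), mul_div_right_comm, ← key, sum_mul]
      refine sum_congr rfl fun i hi => ?_
      rw [Hx.1, nodeProd_succ, nodeProd_succ, nodeProd_two_mul Hg.1, nodeProd_two_mul Hg.1,
        nodeProd_succ, neg_sq, mul_inv, mul_inv, mul_inv, mul_pow, mul_pow, mul_pow, ← mul_add,
        ← neg_add', norm_neg, inv_sq_norm_sub_add_inv_sq_norm_add (hx _) (hg _)
          (hne i (by simpa using hi) a (by omega))]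
      simp only [evenSq]
      ring
    · have key := ih (norm_evenSq hx) (norm_evenSq hg) Hx.2 Hg.2 h0' a (by omega)
      rw [binaryOnes_two_mul_add_one, pow_succ (2 : ℝ), pow_succ (4 : ℝ),
        show (4 : ℝ) ^ n * 4 / (4 * (2 ^ binaryOnes a * 2)) =
          4 ^ n / (4 * 2 ^ binaryOnes a) * 2 by field_simp; norm_num, ← key, sum_mul]
      refine sum_congr rfl fun i hi => ?_
      rw [Hx.1, show 2 * a + 1 + 1 = 2 * (a + 1) by ring, nodeProd_two_mul Hg.1,
        nodeProd_two_mul Hg.1, neg_sq]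
      simp only [evenSq]
      ring

/-- Reciprocals of the derivative of the nodal polynomial at its nodes, weighted by its
reciprocal values at the conjugate nodes. -/
noncomputable def conjWeight (g : ℕ → ℂ) (l : ℕ) : ℝ :=
  ∑ j ∈ range l, (nodeDeriv g l j * nodeProd g l (conj (g j)))⁻¹

/-- The nodes `±w` contribute equally, and the derivative doubles on passing from squares back to
nodes, so the two effects cancel. -/
theorem conjWeight_two_mul {g : ℕ → ℂ} (hg : ∀ j, ‖g j‖ = 1)
    (h : ∀ j, g (2 * j + 1) = -g (2 * j)) (l : ℕ) :
    conjWeight g (2 * l) = conjWeight (evenSq g) l := by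
  unfold conjWeight
  rw [sum_range_two_mul]
  refine sum_congr rfl fun j hj => ?_
  obtain ⟨h1, h2⟩ := nodeDeriv_two_mul hg h (mem_range.1 hj)
  rw [h1, h2, h, nodeProd_two_mul h, nodeProd_two_mul h, map_neg, neg_sq, ← map_pow]
  simp only [evenSq, mul_inv]
  ring

/-- Each pair of nodes carries the extra chords to the unpaired node and their conjugate analogues;
Cauchy–Schwarz bounds the resulting sum by the two reciprocal-square identities. -/
theorem conjWeight_two_mul_add_one_le {g : ℕ → ℂ} (hg : ∀ j, ‖g j‖ = 1)
    (h : ∀ j, g (2 * j + 1) = -g (2 * j)) (l : ℕ)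
    (hne : ∀ j < l, g (2 * j) ^ 2 ≠ g (2 * l) ^ 2)
    (hnc : ∀ j ≤ l, conj (g (2 * j)) ^ 2 ≠ g (2 * l) ^ 2) :
    conjWeight g (2 * l + 1) ≤ 2 * conjWeight (evenSq g) (l + 1) := by
  unfold conjWeight
  rw [sum_range_succ, sum_range_succ, sum_range_two_mul, mul_add, mul_sum]
  refine add_le_add (sum_le_sum fun j hj => ?_) ?_
  · have hj := mem_range.1 hj
    obtain ⟨h1, h2⟩ := nodeDeriv_two_mul hg h hj
    rw [nodeDeriv_succ_of_lt _ (by omega), nodeDeriv_succ_of_lt _ (by omega),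
      nodeDeriv_succ_of_lt _ hj, h1, h2, h, nodeProd_succ, nodeProd_succ, nodeProd_succ,
      nodeProd_two_mul h, nodeProd_two_mul h, map_neg, neg_sq, ← map_pow, ← neg_add', ← neg_add',
      norm_neg, norm_neg]
    have e1 := inv_sq_norm_sub_add_inv_sq_norm_add (hg (2 * j)) (hg (2 * l)) (hne j hj)
    have e2 := inv_sq_norm_sub_add_inv_sq_norm_add (z := conj (g (2 * j)))
      (by rw [RCLike.norm_conj, hg]) (hg (2 * l)) (hnc j hj.le)
    have hD := nodeDeriv_nonneg (evenSq g) l j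
    have hP := nodeProd_nonneg (evenSq g) l (conj (g (2 * j) ^ 2))
    simp only [evenSq] at hD hP ⊢
    rw [← map_pow] at e2
    set D := nodeDeriv _ l j
    set P := nodeProd _ l (conj (g (2 * j) ^ 2))
    set a := ‖g (2 * j) - g (2 * l)‖⁻¹ with ha
    set b := ‖g (2 * j) + g (2 * l)‖⁻¹ with hb
    set c := ‖conj (g (2 * j)) - g (2 * l)‖⁻¹ with hc
    set d := ‖conj (g (2 * j)) + g (2 * l)‖⁻¹ with hd
    set u := ‖g (2 * j) ^ 2 - g (2 * l) ^ 2‖⁻¹ with hu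
    set v := ‖conj (g (2 * j) ^ 2) - g (2 * l) ^ 2‖⁻¹ with hv
    have hu0 : 0 ≤ u := by positivity
    have hv0 : 0 ≤ v := by positivity
    have cs : a * c + b * d ≤ 4 * (u * v) := by
      refine abs_le_of_sq_le_sq' ?_ (by positivity) |>.2
      calc (a * c + b * d) ^ 2 ≤ (a ^ 2 + b ^ 2) * (c ^ 2 + d ^ 2) := by
            nlinarith [sq_nonneg (a * d - b * c)]
        _ = (4 * (u * v)) ^ 2 := by rw [e1, e2]; ring
    simp only [mul_inv, ← ha, ← hb, ← hc, ← hd, ← hu, ← hv]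
    have : 0 ≤ D⁻¹ * P⁻¹ := by positivity
    nlinarith [mul_le_mul_of_nonneg_left cs this]
  · rw [nodeDeriv_succ_self, nodeDeriv_succ_self, nodeProd_succ, nodeProd_succ,
      nodeProd_two_mul h, nodeProd_two_mul h, ← map_pow]
    have hP := nodeProd_nonneg (evenSq g) l (g (2 * l) ^ 2)
    have hQ := nodeProd_nonneg (evenSq g) l (conj (g (2 * l) ^ 2))
    have hne2 := norm_ne_zero_iff.2 (sub_ne_zero.2 (hnc l le_rfl))
    have hs := norm_sub_mul_norm_add (conj (g (2 * l))) (g (2 * l))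
    rw [← hs] at hne2
    rw [← map_pow] at hs
    -- For the unpaired node itself, squaring adds only the factor `|w̄+w|`, which the constant `2`
    -- absorbs.
    have hle : ‖conj (g (2 * l)) + g (2 * l)‖ ≤ 2 :=
      (norm_add_le _ _).trans (by rw [RCLike.norm_conj, hg]; norm_num)
    simp only [evenSq] at hP hQ ⊢
    rw [← hs]
    have h1 := left_ne_zero_of_mul hne2
    have h2 := (norm_nonneg _).lt_of_ne' (right_ne_zero_of_mul hne2)
    simp only [mul_inv]
    set q := ‖conj (g (2 * l)) + g (2 * l)‖
    have hq : 1 ≤ 2 * q⁻¹ := by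
      rw [← div_eq_mul_inv, le_div_iff₀ h2]; linarith
    set P := nodeProd _ l (g (2 * l) ^ 2)
    set Q := nodeProd _ l (conj (g (2 * l) ^ 2))
    have : 0 ≤ P⁻¹ * (Q⁻¹ * ‖conj (g (2 * l)) - g (2 * l)‖⁻¹) := by positivity
    nlinarith [mul_le_mul_of_nonneg_left hq this]

theorem BinarySym.conjWeight_le (n : ℕ) : ∀ {g : ℕ → ℂ}, (∀ j, ‖g j‖ = 1) → BinarySym n g →
    g 0 ^ 2 ^ (n + 1) = -1 → ∀ m < 2 ^ n,
    conjWeight g (m + 1) ≤ 2 ^ n / (2 * 2 ^ binaryOnes m) := by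
  induction n with
  | zero =>
    intro g hg _ h0 m hm
    obtain rfl : m = 0 := by simpa using hm
    have : ‖conj (g 0) - g 0‖ = 2 := by
      have h1 : conj (g 0) * g 0 = 1 := by
        rw [mul_comm, Complex.mul_conj, Complex.normSq_eq_norm_sq, hg]; norm_num
      have h2 : (conj (g 0) - g 0) * g 0 = 2 := by
        simp only [zero_add, pow_one] at h0
        rw [sub_mul, h1, ← sq, h0]; norm_num
      have h3 := congrArg norm h2
      rwa [norm_mul, hg, mul_one, Complex.norm_ofNat] at h3
    simp [conjWeight, nodeDeriv, nodeProd, this, binaryOnes_zero]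
  | succ n ih =>
    intro g hg H h0 m hm
    rw [pow_succ'] at hm
    have h0' : evenSq g 0 ^ 2 ^ (n + 1) = -1 := by
      simp only [evenSq, ← pow_mul, ← pow_succ']
      exact h0
    obtain ⟨a, rfl | rfl⟩ := Nat.even_or_odd' m
    · have key := ih (norm_evenSq hg) H.2 h0' a (by omega)
      refine (conjWeight_two_mul_add_one_le hg H.1 a ?_ ?_).trans ?_
      · intro j hj e
        have := BinarySym.injOn n (norm_evenSq hg) H.2 j (by omega) a (by omega) e
        omega
      · intro j hj e
        have ej := BinarySym.pow_eq _ H (2 * j) (by rw [pow_succ]; omega)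
        have ea := BinarySym.pow_eq _ H (2 * a) (by rw [pow_succ]; omega)
        have e' := congrArg (· ^ 2 ^ n) e
        simp only [← pow_mul, ← pow_succ'] at e'
        rw [← map_pow, ej, ea] at e'
        set t := g 0 ^ 2 ^ (n + 1) with ht
        have ht2 : t ^ 2 = -1 := by rw [ht, ← pow_mul, ← pow_succ]; exact h0
        have h1 : conj t * t = ‖t‖ ^ 2 := by
          rw [mul_comm, Complex.mul_conj, Complex.normSq_eq_norm_sq]; norm_num
        rw [e', ← sq, ht2, ht, norm_pow, hg] at h1
        norm_num at h1
      · rw [binaryOnes_two_mul, pow_succ (2 : ℝ) n, mul_div_right_comm]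
        linarith
    · have key := ih (norm_evenSq hg) H.2 h0' a (by omega)
      rw [show 2 * a + 1 + 1 = 2 * (a + 1) by ring, conjWeight_two_mul hg H.1,
        binaryOnes_two_mul_add_one]
      refine key.trans (le_of_eq ?_)
      rw [pow_succ, pow_succ]
      field_simp

/-! ### Binary symmetry of Leja sequences -/

/-- The conditions defining a Leja sequence initiated at `1`, up to the index `K`. -/
def IsLejaUpTo (K : ℕ) (E : ℕ → ℂ) : Prop :=
  E 0 = 1 ∧ ∀ k, 1 ≤ k → k ≤ K → ‖E k‖ ≤ 1 ∧ ∀ z : ℂ, ‖z‖ ≤ 1 → nodeProd E k z ≤ nodeProd E k (E k)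

/-- Makes the maximum of a nodal product positive, so that it can be cancelled. -/
theorem exists_nodeProd_pos (g : ℕ → ℂ) (m : ℕ) : ∃ z : ℂ, ‖z‖ ≤ 1 ∧ 0 < nodeProd g m z := by
  have hinf : (Metric.closedBall (0 : ℂ) 1).Infinite :=
    (convex_closedBall (0 : ℂ) 1).isPreconnected.infinite_of_nontrivial
      ⟨0, by simp, 1, by simp, zero_ne_one⟩
  obtain ⟨z, hz, hzn⟩ := hinf.exists_notMem_finset ((range m).image g)
  refine ⟨z, by simpa using hz, prod_pos fun i hi => ?_⟩
  rw [norm_pos_iff, sub_ne_zero]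
  rintro rfl
  exact hzn (mem_image_of_mem g hi)

namespace IsLejaUpTo

theorem mono {K L : ℕ} {E : ℕ → ℂ} (h : IsLejaUpTo L E) (hKL : K ≤ L) : IsLejaUpTo K E :=
  ⟨h.1, fun k h1 hk => h.2 k h1 (hk.trans hKL)⟩

/-- Every point of the disc is a square, and the paired nodal product depends only on `z²`. -/
theorem evenSq {k : ℕ} {E : ℕ → ℂ} (h : IsLejaUpTo (2 * k) E)
    (hpair : ∀ j < k, E (2 * j + 1) = -E (2 * j)) : IsLejaUpTo k (evenSq E) := by
  refine ⟨by simp [_root_.evenSq, h.1], fun i h1 hi => ?_⟩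
  obtain ⟨hb, hmax⟩ := h.2 (2 * i) (by omega) (by omega)
  have hp : ∀ j < i, E (2 * j + 1) = -E (2 * j) := fun j hj => hpair j (by omega)
  refine ⟨by simpa [_root_.evenSq] using hb, fun w hw => ?_⟩
  obtain ⟨z, rfl⟩ := IsAlgClosed.exists_pow_nat_eq w (n := 2) (by norm_num)
  have := hmax z (by simpa using hw)
  rwa [nodeProd_two_mul_of_lt hp, nodeProd_two_mul_of_lt hp] at this

/-- The paired nodal product is even, so it is maximal at `-a` as well as at `a`; the remaining
factor `|z-a|` reaches its maximum `2` on the disc only at `-a`. -/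
theorem odd_eq_neg {k : ℕ} {E : ℕ → ℂ} (h : IsLejaUpTo (2 * k + 1) E)
    (hpair : ∀ j < k, E (2 * j + 1) = -E (2 * j)) (hn : ‖E (2 * k)‖ = 1) :
    E (2 * k + 1) = -E (2 * k) := by
  set a := E (2 * k) with ha
  set e := E (2 * k + 1) with he
  obtain ⟨hb, hmax⟩ := h.2 (2 * k + 1) (by omega) le_rfl
  rw [← he] at hb hmax
  have hM : ∀ z : ℂ, ‖z‖ ≤ 1 → nodeProd E (2 * k) z ≤ nodeProd E (2 * k) a := by
    intro z hz
    rcases Nat.eq_zero_or_pos k with rfl | hk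
    · simp [nodeProd]
    · exact (h.2 (2 * k) (by omega) (by omega)).2 z hz
  have hpos : 0 < nodeProd E (2 * k) a := by
    obtain ⟨z, hz, hz0⟩ := exists_nodeProd_pos E (2 * k)
    exact hz0.trans_le (hM z hz)
  have h1 := hmax (-a) (by rw [norm_neg, hn])
  rw [nodeProd_succ, nodeProd_succ, nodeProd_two_mul_of_lt hpair, neg_sq,
    ← nodeProd_two_mul_of_lt hpair, ← ha, ← neg_add', norm_neg, ← two_mul, norm_mul, hn,
    Complex.norm_ofNat, mul_one] at h1
  have h2 := mul_le_mul_of_nonneg_right (hM e hb) (norm_nonneg (e - a))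
  have h3 : 2 ≤ ‖e - a‖ := le_of_mul_le_mul_left (h1.trans h2) hpos
  have hp := parallelogram_law_with_norm ℝ e a
  rw [hn] at hp
  have h4 : ‖e + a‖ * ‖e + a‖ ≤ 0 := by nlinarith [norm_nonneg e]
  have h5 : ‖e + a‖ = 0 := mul_self_eq_zero.1 (h4.antisymm (mul_self_nonneg _))
  exact eq_neg_of_add_eq_zero_left (norm_eq_zero.1 h5)

/-- Unimodularity and pairing are proved together: an even index inherits modulus one from the
squared sequence at half the index, an odd one from its partner. No maximum principle is needed. -/
theorem norm_eq_one_and_pair (K : ℕ) : ∀ {E : ℕ → ℂ}, IsLejaUpTo K E →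
    (∀ k ≤ K, ‖E k‖ = 1) ∧ ∀ j, 2 * j + 1 ≤ K → E (2 * j + 1) = -E (2 * j) := by
  induction K using Nat.strong_induction_on with
  | _ K ih =>
    intro E h
    rcases Nat.eq_zero_or_pos K with rfl | hK
    · refine ⟨fun k hk => ?_, fun j hj => by omega⟩
      obtain rfl : k = 0 := by omega
      simp [h.1]
    obtain ⟨hn, hp⟩ := ih (K - 1) (by omega) (h.mono (by omega))
    have hnorm : ‖E K‖ = 1 → ∀ k ≤ K, ‖E k‖ = 1 := fun hE k hk => by
      rcases hk.eq_or_lt with rfl | hk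
      · exact hE
      · exact hn k (by omega)
    obtain ⟨k, rfl | rfl⟩ := Nat.even_or_odd' K
    · have := (ih k (by omega) (h.evenSq fun j hj => hp j (by omega))).1 k le_rfl
      rw [_root_.evenSq, norm_pow] at this
      exact ⟨hnorm ((pow_eq_one_iff_of_nonneg (norm_nonneg _) two_ne_zero).1 this),
        fun j hj => hp j (by omega)⟩
    · have hodd := h.odd_eq_neg (fun j hj => hp j (by omega)) (hn (2 * k) (by omega))
      refine ⟨hnorm (by rw [hodd, norm_neg, hn (2 * k) (by omega)]), fun j hj => ?_⟩
      rcases Nat.lt_or_ge j k with hjk | hjk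
      · exact hp j (by omega)
      · obtain rfl : j = k := by omega
        exact hodd

end IsLejaUpTo

theorem IsLejaFromOne.isLejaUpTo {E : ℕ → ℂ} (h : IsLejaFromOne E) (K : ℕ) : IsLejaUpTo K E :=
  ⟨h.1, fun k h1 _ => ⟨by simpa using (h.2 k h1).1, fun z hz => (h.2 k h1).2 (by simpa using hz)⟩⟩

theorem IsLejaFromOne.norm_eq_one {E : ℕ → ℂ} (h : IsLejaFromOne E) (k : ℕ) : ‖E k‖ = 1 :=
  (h.isLejaUpTo k).norm_eq_one_and_pair.1 k le_rfl

theorem binarySym_of_isLejaUpTo (n : ℕ) : ∀ {E : ℕ → ℂ}, (∀ K, IsLejaUpTo K E) →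
    BinarySym n E := by
  induction n with
  | zero => intro E _; trivial
  | succ n ih =>
    intro E h
    have hp : ∀ j, E (2 * j + 1) = -E (2 * j) := fun j =>
      (h (2 * j + 1)).norm_eq_one_and_pair.2 j le_rfl
    exact ⟨hp, ih fun K => (h (2 * K)).evenSq fun j _ => hp j⟩

theorem IsLejaFromOne.binarySym {E : ℕ → ℂ} (h : IsLejaFromOne E) (n : ℕ) : BinarySym n E :=
  binarySym_of_isLejaUpTo n h.isLejaUpTo

/-! ### The indices kept by the projection onto the real axis -/

theorem eq_or_eq_conj_of_re_eq {z w : ℂ} (hz : ‖z‖ = 1) (hw : ‖w‖ = 1) (h : z.re = w.re) :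
    z = w ∨ z = conj w := by
  have h1 : z.im ^ 2 = w.im ^ 2 := by
    have e1 := Complex.sq_norm z
    have e2 := Complex.sq_norm w
    rw [hz, Complex.normSq_apply] at e1
    rw [hw, Complex.normSq_apply] at e2
    rw [h] at e1
    linear_combination e2 - e1
  rcases sq_eq_sq_iff_eq_or_eq_neg.1 h1 with h2 | h2
  · exact Or.inl (Complex.ext h h2)
  · exact Or.inr (Complex.ext (by simpa using h) (by simpa using h2))

theorem conj_ne_self_of_sq_eq_neg_one {t : ℂ} (ht : t ^ 2 = -1) : conj t = -t := by
  have h1 : (t - Complex.I) * (t + Complex.I) = 0 := by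
    linear_combination ht - Complex.I_sq
  rcases mul_eq_zero.1 h1 with h | h
  · rw [sub_eq_zero.1 h, Complex.conj_I]
  · rw [eq_neg_of_add_eq_zero_left h, map_neg, Complex.conj_I]

/-- The sequence `E` started at the index `2 ^ (n + 1)`. -/
def dyadicTail (E : ℕ → ℂ) (n : ℕ) : ℕ → ℂ := fun j => E (2 ^ (n + 1) + j)

namespace IsLejaFromOne

variable {E : ℕ → ℂ}

theorem binarySym_dyadicTail (h : IsLejaFromOne E) (n : ℕ) :
    BinarySym (n + 1) (dyadicTail E n) := by
  have := BinarySym.shift (n + 1) 1 (h.binarySym (n + 1))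
  rwa [mul_one] at this

theorem norm_dyadicTail (h : IsLejaFromOne E) (n j : ℕ) : ‖dyadicTail E n j‖ = 1 :=
  h.norm_eq_one _

theorem pow_eq_one (h : IsLejaFromOne E) {n i : ℕ} (hi : i < 2 ^ n) : E i ^ 2 ^ n = 1 := by
  rw [BinarySym.pow_eq n (h.binarySym n) i hi, h.1, one_pow]

theorem dyadicTail_zero_pow (h : IsLejaFromOne E) (n : ℕ) :
    dyadicTail E n 0 ^ 2 ^ (n + 1) = -1 := by
  have := BinarySym.pow_odd (n + 1) (h.binarySym (n + 2)) 0
  simpa [dyadicTail, h.1] using this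

theorem sq_dyadicTail_zero_pow (h : IsLejaFromOne E) (n : ℕ) :
    (dyadicTail E n 0 ^ 2 ^ n) ^ 2 = -1 := by
  rw [← pow_mul, ← pow_succ, h.dyadicTail_zero_pow]

theorem dyadicTail_pow (h : IsLejaFromOne E) {n m : ℕ} (hm : m < 2 ^ n) :
    dyadicTail E n m ^ 2 ^ n = dyadicTail E n 0 ^ 2 ^ n :=
  BinarySym.pow_eq n (h.binarySym_dyadicTail n).of_succ m hm

theorem dyadicTail_pow_succ (h : IsLejaFromOne E) {n m : ℕ} (hm : m < 2 ^ (n + 1)) :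
    dyadicTail E n m ^ 2 ^ (n + 1) = -1 := by
  rw [BinarySym.pow_eq (n + 1) (h.binarySym_dyadicTail n) m hm, h.dyadicTail_zero_pow]

theorem dyadicTail_two_pow_pow (h : IsLejaFromOne E) (n : ℕ) :
    dyadicTail E n (2 ^ n) ^ 2 ^ n = -dyadicTail E n 0 ^ 2 ^ n := by
  have := BinarySym.pow_odd n (h.binarySym (n + 1)) 1
  rw [show 2 ^ n * (2 * 1 + 1) = 2 ^ (n + 1) + 2 ^ n by ring,
    show 2 ^ n * (2 * 1) = 2 ^ (n + 1) + 0 by ring] at this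
  exact this

/-- Equal real parts would mean equal or conjugate points. Earlier blocks have `2^(n+1)`-th power
`1` instead of `-1`; within the half block all `2^n`-th powers equal one `t` with `t² = -1`, so `t̄
= -t ≠ t` excludes conjugates. -/
theorem re_ne_of_lt (h : IsLejaFromOne E) {n m i : ℕ} (hm : m < 2 ^ n)
    (hi : i < 2 ^ (n + 1) + m) : (E (2 ^ (n + 1) + m)).re ≠ (E i).re := by
  intro hre
  have hm' : m < 2 ^ (n + 1) := by rw [pow_succ]; omega
  have e := h.dyadicTail_pow_succ hm'
  rcases Nat.lt_or_ge i (2 ^ (n + 1)) with hi' | hi'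
  · have h1 := h.pow_eq_one hi'
    rcases eq_or_eq_conj_of_re_eq (h.norm_eq_one _) (h.norm_eq_one _) hre with h2 | h2
    all_goals
      rw [dyadicTail, h2] at e
      try rw [← map_pow] at e
      rw [h1] at e
      norm_num at e
  · obtain ⟨j, rfl⟩ := Nat.exists_eq_add_of_le hi'
    rcases eq_or_eq_conj_of_re_eq (h.norm_eq_one _) (h.norm_eq_one _) hre with h2 | h2
    · have := BinarySym.injOn (n + 1) (h.norm_dyadicTail n) (h.binarySym_dyadicTail n) m hm' j
        (by omega) h2
      omega
    · have h3 := h.dyadicTail_pow hm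
      rw [dyadicTail, h2, ← map_pow] at h3
      change conj (dyadicTail E n j ^ 2 ^ n) = _ at h3
      rw [h.dyadicTail_pow (by omega), conj_ne_self_of_sq_eq_neg_one (h.sq_dyadicTail_zero_pow n)]
        at h3
      have h4 := h.sq_dyadicTail_zero_pow n
      rw [neg_eq_self.1 h3] at h4
      norm_num at h4

/-- The second half of the block has `2^n`-th power `-t = t̄`, so it consists of conjugates of the
first half. -/
theorem exists_re_eq (h : IsLejaFromOne E) {n m : ℕ} (hm : m < 2 ^ n) :
    ∃ i < 2 ^ n, (E (2 ^ (n + 1) + (2 ^ n + m))).re = (E (2 ^ (n + 1) + i)).re := by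
  have hs : BinarySym n fun j => E (2 ^ (n + 1) + (2 ^ n + j)) := by
    -- The second half starts at `2^(n+1) + 2^n = 3·2^n`.
    have := BinarySym.shift n 3 (h.binarySym n)
    convert this using 3
    ring
  have h1 := BinarySym.pow_eq n hs m hm
  obtain ⟨i, hi, hie⟩ := BinarySym.exists_of_pow_eq n (h.binarySym_dyadicTail n).of_succ
    (conj (E (2 ^ (n + 1) + (2 ^ n + m)))) (by
      rw [← map_pow, h1]
      change conj (dyadicTail E n (2 ^ n) ^ 2 ^ n) = _
      rw [h.dyadicTail_two_pow_pow, map_neg,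
        conj_ne_self_of_sq_eq_neg_one (h.sq_dyadicTail_zero_pow n), neg_neg])
  refine ⟨i, hi, ?_⟩
  change _ = (dyadicTail E n i).re
  rw [hie, Complex.conj_re]

end IsLejaFromOne

section Projection

variable {E : ℕ → ℂ} {R : ℕ → Set.Icc (-1 : ℝ) 1} {J : ℕ → ℕ}

theorem exists_re_eq_of_le (hJ0 : J 0 = 0)
    (hJ : ∀ k : ℕ, 1 ≤ k →
      IsLeast {j : ℕ | J (k - 1) < j ∧ ∀ i < k, (E j).re ≠ (R i : ℝ)} (J k))
    (hR : ∀ k : ℕ, (R k : ℝ) = (E (J k)).re) (k : ℕ) :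
    ∀ j ≤ J k, ∃ i ≤ k, (E j).re = (R i : ℝ) := by
  induction k with
  | zero =>
    intro j hj
    refine ⟨0, le_rfl, ?_⟩
    rw [hR, hJ0]
    rw [hJ0] at hj
    rw [Nat.le_zero.1 hj]
  | succ k ih =>
    intro j hj
    rcases Nat.lt_or_ge (J k) j with h1 | h1
    · rcases hj.eq_or_lt with rfl | h2
      · exact ⟨k + 1, le_rfl, (hR _).symm⟩
      · by_contra! hcon
        exact absurd ((hJ (k + 1) (by omega)).2 ⟨h1, fun i hi => hcon i (by omega)⟩) (by omega)
    · obtain ⟨i, hi, hie⟩ := ih j h1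
      exact ⟨i, by omega, hie⟩

theorem projection_index_succ (hJ0 : J 0 = 0)
    (hJ : ∀ k : ℕ, 1 ≤ k →
      IsLeast {j : ℕ | J (k - 1) < j ∧ ∀ i < k, (E j).re ≠ (R i : ℝ)} (J k))
    (hR : ∀ k : ℕ, (R k : ℝ) = (E (J k)).re) {k j : ℕ} (hj : J k < j)
    (hnew : ∀ i < j, (E j).re ≠ (E i).re)
    (hold : ∀ j', J k < j' → j' < j → ∃ i ≤ J k, (E j').re = (E i).re) : J (k + 1) = j := by
  have hleast := hJ (k + 1) (by omega)
  have hle : ∀ i ≤ k, J i ≤ J k := by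
    intro i hi
    have : StrictMono J := strictMono_nat_of_lt_succ fun i => (hJ (i + 1) (by omega)).1.1
    exact this.monotone hi
  refine hleast.unique ⟨⟨hj, fun i hi => ?_⟩, fun j' hj' => ?_⟩
  · rw [hR]
    exact hnew _ ((hle i (by omega)).trans_lt hj)
  · by_contra! hlt
    obtain ⟨i, hi, hie⟩ := hold j' hj'.1 hlt
    obtain ⟨i', hi', hie'⟩ := exists_re_eq_of_le hJ0 hJ hR k i hi
    exact hj'.2 i' (by omega) (hie.trans hie')

theorem projection_index_one (hE : IsLejaFromOne E) (hJ0 : J 0 = 0)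
    (hJ : ∀ k : ℕ, 1 ≤ k →
      IsLeast {j : ℕ | J (k - 1) < j ∧ ∀ i < k, (E j).re ≠ (R i : ℝ)} (J k))
    (hR : ∀ k : ℕ, (R k : ℝ) = (E (J k)).re) : J 1 = 1 := by
  refine projection_index_succ hJ0 hJ hR (k := 0) (by omega) (fun i hi => ?_)
    fun j' h1 h2 => by omega
  obtain rfl : i = 0 := by omega
  have := (hE.binarySym 1).1 0
  simp only [mul_zero, zero_add] at this
  rw [this, hE.1]
  norm_num

theorem projection_index (hE : IsLejaFromOne E) (hJ0 : J 0 = 0)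
    (hJ : ∀ k : ℕ, 1 ≤ k →
      IsLeast {j : ℕ | J (k - 1) < j ∧ ∀ i < k, (E j).re ≠ (R i : ℝ)} (J k))
    (hR : ∀ k : ℕ, (R k : ℝ) = (E (J k)).re) (n : ℕ) :
    ∀ m < 2 ^ n, J (2 ^ n + 1 + m) = 2 ^ (n + 1) + m := by
  have step : ∀ n, J (2 ^ n + 1) = 2 ^ (n + 1) → ∀ m < 2 ^ n,
      J (2 ^ n + 1 + m) = 2 ^ (n + 1) + m := by
    intro n h0 m
    induction m with
    | zero => intro _; exact h0
    | succ m ih =>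
      intro hm
      have := ih (by omega)
      exact projection_index_succ hJ0 hJ hR (k := 2 ^ n + 1 + m) (by omega)
        (fun i hi => hE.re_ne_of_lt hm hi) fun j' h1 h2 => by omega
  refine step n ?_
  induction n with
  | zero =>
    have h1 := projection_index_one hE hJ0 hJ hR
    exact projection_index_succ hJ0 hJ hR (k := 1) (by omega)
      (fun i hi => hE.re_ne_of_lt (n := 0) (m := 0) (by simp) hi) fun j' h3 h2 => by omega
  | succ n ih =>
    have hpos : 0 < 2 ^ n := by positivity
    have h2 : 2 ^ (n + 1) = 2 ^ n + 2 ^ n := by ring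
    have h3 := step n ih (2 ^ n - 1) (by omega)
    rw [show 2 ^ n + 1 + (2 ^ n - 1) = 2 ^ (n + 1) by omega] at h3
    have h4 : 2 ^ (n + 1 + 1) = 2 ^ (n + 1) + (2 ^ n + 2 ^ n) := by ring
    refine projection_index_succ hJ0 hJ hR (by omega)
      (fun i hi => hE.re_ne_of_lt (n := n + 1) (m := 0) (by positivity) hi) fun j' h5 h6 => ?_
    obtain ⟨i, hi, hie⟩ := hE.exists_re_eq (n := n) (m := j' - (2 ^ (n + 1) + 2 ^ n)) (by omega)
    rw [show 2 ^ (n + 1) + (2 ^ n + (j' - (2 ^ (n + 1) + 2 ^ n))) = j' by omega] at hie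
    exact ⟨_, by omega, hie⟩

end Projection

/-! ### Chord products of the projected sequence -/

theorem norm_conj_sub (z w : ℂ) : ‖conj z - w‖ = ‖z - conj w‖ := by
  rw [← RCLike.norm_conj (z - conj w), map_sub, Complex.conj_conj]

theorem norm_sq_sub_one {z : ℂ} (hz : ‖z‖ = 1) : ‖z ^ 2 - 1‖ = ‖conj z - z‖ := by
  have h1 : conj z * z = 1 := by
    rw [mul_comm, Complex.mul_conj, Complex.normSq_eq_norm_sq, hz]; norm_num
  have h2 : z ^ 2 - 1 = -((conj z - z) * z) := by rw [sub_mul, h1]; ring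
  rw [h2, norm_neg, norm_mul, hz, mul_one]

theorem norm_sub_mul_norm_conj_sub {z w : ℂ} (hz : ‖z‖ = 1) (hw : ‖w‖ = 1) :
    ‖z - w‖ * ‖conj z - w‖ = 2 * |z.re - w.re| := by
  have h1 : z * conj z = 1 := by rw [Complex.mul_conj, Complex.normSq_eq_norm_sq, hz]; norm_num
  have h2 : w * conj w = 1 := by rw [Complex.mul_conj, Complex.normSq_eq_norm_sq, hw]; norm_num
  have h3 : z + conj z = ((2 * z.re : ℝ) : ℂ) := Complex.add_conj z
  have h4 : w + conj w = ((2 * w.re : ℝ) : ℂ) := Complex.add_conj w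
  have h5 : (z - w) * (conj z - w) = -(w * ((2 * (z.re - w.re) : ℝ) : ℂ)) := by
    have : ((2 * (z.re - w.re) : ℝ) : ℂ) = z + conj z - (w + conj w) := by
      rw [h3, h4]; push_cast; ring
    rw [this]
    linear_combination h1 - h2
  rw [← norm_mul, h5, norm_neg, norm_mul, hw, one_mul, Complex.norm_real, Real.norm_eq_abs,
    abs_mul, abs_two]

/-- The product of `‖c j - c i‖ * ‖conj (c j) - c i‖` over `i < k`, `i ≠ j`. -/
noncomputable def chordDeriv (c : ℕ → ℂ) (k j : ℕ) : ℝ :=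
  ∏ i ∈ range k, if i = j then 1 else ‖c j - c i‖ * ‖conj (c j) - c i‖

theorem chordDeriv_nonneg (c : ℕ → ℂ) (k j : ℕ) : 0 ≤ chordDeriv c k j :=
  prod_nonneg fun _ _ => by split_ifs <;> positivity

theorem chordDeriv_mul_norm (g : ℕ → ℂ) {l m : ℕ} (hm : m < l) :
    chordDeriv g l m * ‖conj (g m) - g m‖ = nodeDeriv g l m * nodeProd g l (conj (g m)) := by
  have hm := mem_range.2 hm
  unfold chordDeriv nodeDeriv nodeProd
  rw [← mul_prod_erase _ _ hm, ← mul_prod_erase _ _ hm, ← mul_prod_erase _ _ hm, if_pos rfl,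
    if_pos rfl, one_mul, one_mul, mul_left_comm, mul_comm, ← prod_mul_distrib]
  congr 1
  refine prod_congr rfl fun i hi => ?_
  rw [if_neg (ne_of_mem_erase hi), if_neg (ne_of_mem_erase hi)]

theorem nodeProd_add (c : ℕ → ℂ) (k l : ℕ) (z : ℂ) :
    nodeProd c (k + l) z = nodeProd c k z * nodeProd (fun i => c (k + i)) l z :=
  prod_range_add _ _ _

theorem nodeProd_congr {g h : ℕ → ℂ} {l : ℕ} (H : ∀ i < l, g i = h i) (z : ℂ) :
    nodeProd g l z = nodeProd h l z :=
  prod_congr rfl fun i hi => by rw [H i (mem_range.1 hi)]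

theorem chordDeriv_congr {g h : ℕ → ℂ} {l m : ℕ} (H : ∀ i < l, g i = h i) (hm : m < l) :
    chordDeriv g l m = chordDeriv h l m :=
  prod_congr rfl fun i hi => by rw [H i (mem_range.1 hi), H m hm]

theorem chordDeriv_add_of_lt (c : ℕ → ℂ) {k j : ℕ} (l : ℕ) (hj : j < k) :
    chordDeriv c (k + l) j = chordDeriv c k j *
      (nodeProd (fun i => c (k + i)) l (c j) * nodeProd (fun i => c (k + i)) l (conj (c j))) := by
  unfold chordDeriv nodeProd
  rw [prod_range_add, ← prod_mul_distrib]
  congr 1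
  exact prod_congr rfl fun i _ => if_neg (by omega)

theorem chordDeriv_add (c : ℕ → ℂ) (k l m : ℕ) :
    chordDeriv c (k + l) (k + m) =
      nodeProd c k (c (k + m)) * nodeProd c k (conj (c (k + m))) *
        chordDeriv (fun i => c (k + i)) l m := by
  unfold chordDeriv nodeProd
  rw [prod_range_add, ← prod_mul_distrib]
  congr 1
  · refine prod_congr rfl fun i hi => if_neg ?_
    have := mem_range.1 hi
    omega
  · refine prod_congr rfl fun i _ => ?_
    simp only [Nat.add_left_cancel_iff]

/-- The points of a Leja sequence `E` kept by the projection onto the real axis. -/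
structure IsProjectionLift (E c : ℕ → ℂ) : Prop where
  leja : IsLejaFromOne E
  zero : c 0 = 1
  one : c 1 = -1
  tail : ∀ n, ∀ m < 2 ^ n, c (2 ^ n + 1 + m) = dyadicTail E n m

namespace IsProjectionLift

variable {E c : ℕ → ℂ}

theorem nodeProd_tail (h : IsProjectionLift E c) {n l : ℕ} (hl : l ≤ 2 ^ n) (z : ℂ) :
    nodeProd (fun i => c (2 ^ n + 1 + i)) l z = nodeProd (dyadicTail E n) l z :=
  nodeProd_congr (fun i hi => h.tail n i (by omega)) z

theorem nodeProd_tail_two_pow (h : IsProjectionLift E c) (n : ℕ) (z : ℂ) :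
    nodeProd (dyadicTail E n) (2 ^ n) z * nodeProd (dyadicTail E n) (2 ^ n) (conj z) =
      ‖z ^ 2 ^ (n + 1) + 1‖ := by
  have hs := (h.leja.binarySym_dyadicTail n).of_succ
  have ht := h.leja.sq_dyadicTail_zero_pow n
  rw [BinarySym.nodeProd_two_pow n hs, BinarySym.nodeProd_two_pow n hs, ← map_pow, norm_conj_sub,
    conj_ne_self_of_sq_eq_neg_one ht, sub_neg_eq_add, norm_sub_mul_norm_add, ht, ← pow_mul,
    ← pow_succ, sub_neg_eq_add]

/-- The nodes and their conjugates run over the `2^(n+1)`-th roots of unity, with `±1` counted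
twice; hence the extra `z² - 1`. -/
theorem nodeProd_mul_conj (h : IsProjectionLift E c) (n : ℕ) (z : ℂ) :
    nodeProd c (2 ^ n + 1) z * nodeProd c (2 ^ n + 1) (conj z) =
      ‖z ^ 2 ^ (n + 1) - 1‖ * ‖z ^ 2 - 1‖ := by
  induction n with
  | zero =>
    have : ∀ w, nodeProd c 2 w = ‖w ^ 2 - 1‖ := fun w => by
      have := norm_sub_mul_norm_add w 1
      rw [one_pow] at this
      rw [← this]
      simp [nodeProd, prod_range_succ, h.zero, h.one]
    norm_num
    rw [this, this, ← map_pow, norm_conj_sub, map_one]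
  | succ n ih =>
    rw [show 2 ^ (n + 1) + 1 = 2 ^ n + 1 + 2 ^ n by ring,
      nodeProd_add _ (2 ^ n + 1), nodeProd_add _ (2 ^ n + 1),
      h.nodeProd_tail le_rfl, h.nodeProd_tail le_rfl, mul_mul_mul_comm, ih,
      h.nodeProd_tail_two_pow, mul_right_comm]
    have := norm_sub_mul_norm_add (z ^ 2 ^ (n + 1)) 1
    rw [this, one_pow, ← pow_mul, ← pow_succ]

theorem norm_eq_one_and_pow (h : IsProjectionLift E c) (n : ℕ) :
    ∀ j < 2 ^ n + 1, ‖c j‖ = 1 ∧ c j ^ 2 ^ (n + 1) = 1 := by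
  induction n with
  | zero =>
    intro j hj
    obtain rfl | rfl : j = 0 ∨ j = 1 := by simp at hj; omega
    · simp [h.zero]
    · simp [h.one]
  | succ n ih =>
    intro j hj
    rcases Nat.lt_or_ge j (2 ^ n + 1) with hj' | hj'
    · obtain ⟨h1, h2⟩ := ih j hj'
      exact ⟨h1, by rw [pow_succ, pow_mul, h2, one_pow]⟩
    · obtain ⟨m, rfl⟩ := Nat.exists_eq_add_of_le hj'
      rw [pow_succ] at hj
      have hm : m < 2 ^ n := by omega
      rw [h.tail n m hm]
      refine ⟨h.leja.norm_dyadicTail n m, ?_⟩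
      rw [pow_succ, pow_mul, h.leja.dyadicTail_pow_succ (by rw [pow_succ]; omega)]
      norm_num

theorem norm_eq_one (h : IsProjectionLift E c) (j : ℕ) : ‖c j‖ = 1 :=
  (h.norm_eq_one_and_pow j j (Nat.lt_two_pow_self.trans (Nat.lt_succ_self _))).1

/-- At a new node `|z^(2^(n+1)) - 1| = 2`, and `|z² - 1| = |z̄ - z|` supplies the diagonal factor
missing from `chordDeriv`. -/
theorem chordDeriv_tail (h : IsProjectionLift E c) {n l m : ℕ} (hl : l ≤ 2 ^ n) (hm : m < l) :
    chordDeriv c (2 ^ n + 1 + l) (2 ^ n + 1 + m) =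
      2 * (nodeDeriv (dyadicTail E n) l m *
        nodeProd (dyadicTail E n) l (conj (dyadicTail E n m))) := by
  rw [chordDeriv_add, h.nodeProd_mul_conj, h.tail n m (by omega),
    chordDeriv_congr (fun i hi => h.tail n i (by omega)) hm,
    h.leja.dyadicTail_pow_succ (by rw [pow_succ]; omega),
    norm_sq_sub_one (h.leja.norm_dyadicTail n m), ← chordDeriv_mul_norm _ hm]
  norm_num
  ring

theorem chordDeriv_tail_two_pow (h : IsProjectionLift E c) {n m : ℕ} (hm : m < 2 ^ n) :
    chordDeriv c (2 ^ n + 1 + 2 ^ n) (2 ^ n + 1 + m) = 4 * 2 ^ n := by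
  have hs := (h.leja.binarySym_dyadicTail n).of_succ
  have ht := h.leja.sq_dyadicTail_zero_pow n
  rw [h.chordDeriv_tail le_rfl hm, BinarySym.nodeDeriv_two_pow n (h.leja.norm_dyadicTail n) hs m hm,
    BinarySym.nodeProd_two_pow n hs, ← map_pow, h.leja.dyadicTail_pow hm,
    conj_ne_self_of_sq_eq_neg_one ht, ← neg_add', norm_neg, ← two_mul, norm_mul, norm_pow,
    h.leja.norm_dyadicTail]
  norm_num
  ring

theorem chordDeriv_succ_of_lt (h : IsProjectionLift E c) {n j : ℕ} (hj : j < 2 ^ n + 1) :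
    chordDeriv c (2 ^ n + 1 + 2 ^ n) j = 2 * chordDeriv c (2 ^ n + 1) j := by
  rw [chordDeriv_add_of_lt _ _ hj, h.nodeProd_tail le_rfl, h.nodeProd_tail le_rfl,
    h.nodeProd_tail_two_pow, (h.norm_eq_one_and_pow n j hj).2]
  norm_num
  ring

/-- The weight `4·2^n / chordDeriv` is `1` at `±1` and `2` at every other node, so averaging over
conjugates sums `φ` over all roots of unity. -/
theorem sum_chordDeriv_inv_mul (h : IsProjectionLift E c) (φ : ℂ → ℝ) (n : ℕ) :
    ∑ j ∈ range (2 ^ n + 1),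
        4 * 2 ^ n * (chordDeriv c (2 ^ n + 1) j)⁻¹ * ((φ (c j) + φ (conj (c j))) / 2) =
      ∑ i ∈ range (2 ^ (n + 1)), φ (E i) := by
  induction n with
  | zero =>
    have h1 : E 1 = -1 := by
      have := (h.leja.binarySym 1).1 0
      simpa [h.leja.1] using this
    norm_num [sum_range_succ, chordDeriv, prod_range_succ, h.zero, h.one, h1, h.leja.1]
  | succ n ih =>
    have hs := (h.leja.binarySym_dyadicTail n).of_succ
    rw [show 2 ^ (n + 1) + 1 = 2 ^ n + 1 + 2 ^ n by ring, sum_range_add,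
      show 2 ^ (n + 1 + 1) = 2 ^ (n + 1) + (2 ^ n + 2 ^ n) by ring,
      sum_range_add _ (2 ^ (n + 1)), sum_range_add _ (2 ^ n) (2 ^ n), ← ih]
    congr 1
    · refine sum_congr rfl fun j hj => ?_
      rw [h.chordDeriv_succ_of_lt (mem_range.1 hj), mul_inv, pow_succ]
      ring
    · have hsum : ∑ x ∈ range (2 ^ n), φ (E (2 ^ (n + 1) + (2 ^ n + x))) =
          ∑ x ∈ range (2 ^ n), φ (conj (dyadicTail E n x)) := by
        refine BinarySym.sum_eq_sum_of_pow_eq (g := fun x => dyadicTail E n (2 ^ n + x))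
          (h := fun x => conj (dyadicTail E n x)) (fun j => h.leja.norm_dyadicTail n _)
          (fun j => by rw [RCLike.norm_conj, h.leja.norm_dyadicTail]) ?_
          (BinarySym.conj_seq n hs) ?_ φ
        · have := BinarySym.shift n 1 hs
          rwa [mul_one] at this
        · rw [add_zero, h.leja.dyadicTail_two_pow_pow, ← map_pow,
            conj_ne_self_of_sq_eq_neg_one (h.leja.sq_dyadicTail_zero_pow n)]
      rw [hsum, ← sum_add_distrib]
      refine sum_congr rfl fun m hm => ?_
      rw [h.chordDeriv_tail_two_pow (mem_range.1 hm), h.tail n m (mem_range.1 hm), pow_succ]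
      simp only [dyadicTail]
      field_simp

theorem nodeProd_mul_conj_le (h : IsProjectionLift E c) {n m : ℕ} (hm : m < 2 ^ n) {z : ℂ}
    (hz : ‖z‖ = 1) :
    nodeProd c (2 ^ n + 1 + m) z * nodeProd c (2 ^ n + 1 + m) (conj z) ≤
      4 * (2 ^ binaryOnes m * 2 ^ binaryOnes (m + 1)) := by
  have hzc : ‖conj z‖ = 1 := by rw [RCLike.norm_conj, hz]
  rw [nodeProd_add _ (2 ^ n + 1), nodeProd_add _ (2 ^ n + 1), h.nodeProd_tail hm.le, h.nodeProd_tail hm.le, mul_mul_mul_comm,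
    h.nodeProd_mul_conj, norm_sq_sub_one hz]
  set g := dyadicTail E n
  have hs : BinarySym n g := (h.leja.binarySym_dyadicTail n).of_succ
  have hg : ∀ j, ‖g j‖ = 1 := h.leja.norm_dyadicTail n
  have a1 := BinarySym.nodeProd_le n hg hs m hm.le z hz
  have a2 := BinarySym.nodeProd_le n hg hs m hm.le _ hzc
  have b1 := BinarySym.nodeProd_le n hg hs (m + 1) hm z hz
  have b2 := BinarySym.nodeProd_le n hg hs (m + 1) hm _ hzc
  rw [nodeProd_succ] at b1 b2
  have p1 := nodeProd_nonneg g m z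
  have p2 := nodeProd_nonneg g m (conj z)
  have hA : ‖z ^ 2 ^ (n + 1) - 1‖ ≤ 2 :=
    (norm_sub_le _ _).trans (by rw [norm_pow, hz]; norm_num)
  -- Splitting this chord at the next node `g m` promotes one of the two products from `m` to `m +
  -- 1` nodes, yielding `σ₁(m) + σ₁(m+1)` rather than `2σ₁(m)`.
  have hB : ‖conj z - z‖ ≤ ‖conj z - g m‖ + ‖z - g m‖ := by
    have := norm_sub_le (conj z - g m) (z - g m)
    rwa [sub_sub_sub_cancel_right] at this
  have c1 := mul_le_mul a2 b1 (by positivity) (by positivity)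
  have c2 := mul_le_mul a1 b2 (by positivity) (by positivity)
  have d := mul_le_mul hA (mul_le_mul_of_nonneg_right hB (mul_nonneg p1 p2)) (by positivity)
    zero_le_two
  rw [mul_assoc]
  refine d.trans ?_
  linarith

theorem sum_chordDeriv_inv_le (h : IsProjectionLift E c) {n m : ℕ} (hm : m < 2 ^ n) :
    ∑ j ∈ range (2 ^ n + 1 + m + 1), (chordDeriv c (2 ^ n + 1 + m + 1) j)⁻¹ ≤
      2 ^ n / (2 * 2 ^ binaryOnes m) := by
  rw [add_assoc, sum_range_add]
  have hs := h.leja.binarySym_dyadicTail n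
  have hg := h.leja.norm_dyadicTail n
  have hA := BinarySym.sum_inv_sq_nodeProd (n + 1) h.leja.norm_eq_one hg (h.leja.binarySym _) hs
    (by rw [h.leja.1, h.leja.dyadicTail_zero_pow]; simp) m (by rw [pow_succ]; omega)
  have hB := BinarySym.conjWeight_le n hg hs.of_succ (h.leja.dyadicTail_zero_pow n) m hm
  have h1 : ∑ j ∈ range (2 ^ n + 1), (chordDeriv c (2 ^ n + 1 + (m + 1)) j)⁻¹ ≤
      (4 * 2 ^ n)⁻¹ * (4 ^ (n + 1) / (4 * 2 ^ binaryOnes m)) := by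
    rw [← hA, ← h.sum_chordDeriv_inv_mul fun z => (nodeProd (dyadicTail E n) (m + 1) z)⁻¹ ^ 2,
      mul_sum]
    refine sum_le_sum fun j hj => ?_
    rw [chordDeriv_add_of_lt _ _ (mem_range.1 hj), h.nodeProd_tail hm, h.nodeProd_tail hm,
      mul_inv, mul_inv]
    have hD := inv_nonneg.2 (chordDeriv_nonneg c (2 ^ n + 1) j)
    set D := (chordDeriv c (2 ^ n + 1) j)⁻¹
    set u := (nodeProd (dyadicTail E n) (m + 1) (c j))⁻¹
    set v := (nodeProd (dyadicTail E n) (m + 1) (conj (c j)))⁻¹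
    rw [show ((4 : ℝ) * 2 ^ n)⁻¹ * (4 * 2 ^ n * D * ((u ^ 2 + v ^ 2) / 2)) =
      D * ((u ^ 2 + v ^ 2) / 2) by field_simp]
    -- AM-GM decouples a node from its conjugate.
    exact mul_le_mul_of_nonneg_left (by linarith [two_mul_le_add_sq u v]) hD
  have h2 : ∑ j ∈ range (m + 1), (chordDeriv c (2 ^ n + 1 + (m + 1)) (2 ^ n + 1 + j))⁻¹ =
      2⁻¹ * conjWeight (dyadicTail E n) (m + 1) := by
    unfold conjWeight
    rw [mul_sum]
    refine sum_congr rfl fun j hj => ?_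
    rw [h.chordDeriv_tail hm (mem_range.1 hj), mul_inv]
  have h3 : ((4 : ℝ) * 2 ^ n)⁻¹ * (4 ^ (n + 1) / (4 * 2 ^ binaryOnes m)) +
      2⁻¹ * (2 ^ n / (2 * 2 ^ binaryOnes m)) = 2 ^ n / (2 * 2 ^ binaryOnes m) := by
    rw [show (4 : ℝ) ^ (n + 1) = 4 * (2 ^ n * 2 ^ n) by
      rw [pow_succ, ← mul_pow]; norm_num; ring]
    field_simp
    norm_num
  rw [h2]
  linarith

theorem nodeProd_mul_sum_le (h : IsProjectionLift E c) {n m : ℕ} (hm : m < 2 ^ n) {z : ℂ}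
    (hz : ‖z‖ = 1) :
    nodeProd c (2 ^ n + 1 + m) z * nodeProd c (2 ^ n + 1 + m) (conj z) *
        ∑ j ∈ range (2 ^ n + 1 + m + 1), (chordDeriv c (2 ^ n + 1 + m + 1) j)⁻¹ ≤
      2 * 2 ^ binaryOnes (m + 1) * 2 ^ n := by
  refine (mul_le_mul (h.nodeProd_mul_conj_le hm hz) (h.sum_chordDeriv_inv_le hm)
    (sum_nonneg fun j _ => inv_nonneg.2 (chordDeriv_nonneg _ _ _)) (by positivity)).trans
    (le_of_eq ?_)
  field_simp
  norm_num

end IsProjectionLift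

theorem exists_norm_eq_one_re_eq (x : Set.Icc (-1 : ℝ) 1) : ∃ z : ℂ, ‖z‖ = 1 ∧ z.re = x := by
  refine ⟨Complex.exp (Real.arccos x * Complex.I), Complex.norm_exp_ofReal_mul_I _, ?_⟩
  rw [Complex.exp_ofReal_mul_I_re, Real.cos_arccos x.2.1 x.2.2]

/-- The values on the circle of the nodal polynomial and of its derivatives determine those of
the projected nodes. -/
theorem abs_prod_mul_sum_eq {c : ℕ → ℂ} (hc : ∀ j, ‖c j‖ = 1) {z : ℂ} (hz : ‖z‖ = 1) (k : ℕ) :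
    |∏ i ∈ range k, (z.re - (c i).re)| *
        ∑ j ∈ range (k + 1), (∏ i ∈ (range (k + 1)).erase j, |(c j).re - (c i).re|)⁻¹ =
      nodeProd c k z * nodeProd c k (conj z) *
        ∑ j ∈ range (k + 1), (chordDeriv c (k + 1) j)⁻¹ := by
  have h1 : nodeProd c k z * nodeProd c k (conj z) =
      2 ^ k * |∏ i ∈ range k, (z.re - (c i).re)| := by
    unfold nodeProd
    rw [← prod_mul_distrib, abs_prod]
    simp_rw [norm_sub_mul_norm_conj_sub hz (hc _)]
    rw [prod_mul_distrib]
    simp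
  have h2 : ∀ j ∈ range (k + 1), (chordDeriv c (k + 1) j)⁻¹ =
      (2 ^ k)⁻¹ * (∏ i ∈ (range (k + 1)).erase j, |(c j).re - (c i).re|)⁻¹ := by
    intro j hj
    unfold chordDeriv
    rw [← mul_prod_erase _ _ hj, if_pos rfl, one_mul, ← mul_inv]
    congr 1
    rw [prod_congr rfl fun i hi => (if_neg (ne_of_mem_erase hi)).trans
      (norm_sub_mul_norm_conj_sub (hc j) (hc i)), prod_mul_distrib, prod_const, card_erase_of_mem hj]
    simp
  rw [h1, sum_congr rfl h2, ← mul_sum]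
  field_simp

/-! ### The difference operators -/

/-- Adding the node `v k` multiplies the basis polynomial by `(x - v k)/(v j - v k)`, which exceeds
`1` by `(x - v j)/(v j - v k)`. -/
theorem lagrange_basis_succ_sub (v : ℕ → ℝ) {k j : ℕ} (hj : j < k) (hne : v j ≠ v k) (x : ℝ) :
    (Lagrange.basis (range (k + 1)) v j).eval x - (Lagrange.basis (range k) v j).eval x =
      (∏ i ∈ range k, (x - v i)) * (∏ i ∈ (range (k + 1)).erase j, (v j - v i))⁻¹ := by
  have he : (range (k + 1)).erase j = insert k ((range k).erase j) := by
    rw [range_add_one, erase_insert_of_ne (by omega)]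
  have hk : k ∉ (range k).erase j := by simp
  simp only [Lagrange.basis, Polynomial.eval_prod, Lagrange.basisDivisor, Polynomial.eval_mul,
    Polynomial.eval_C, Polynomial.eval_sub, Polynomial.eval_X]
  rw [he, prod_insert hk, prod_insert hk, prod_mul_distrib, prod_inv_distrib,
    ← mul_prod_erase _ _ (mem_range.2 hj), mul_inv]
  have := sub_ne_zero.2 hne
  field_simp
  ring

theorem lagrange_basis_succ_self (v : ℕ → ℝ) (k : ℕ) (x : ℝ) :
    (Lagrange.basis (range (k + 1)) v k).eval x =
      (∏ i ∈ range k, (x - v i)) * (∏ i ∈ (range (k + 1)).erase k, (v k - v i))⁻¹ := by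
  have he : (range (k + 1)).erase k = range k := by
    rw [range_add_one, erase_insert (by simp)]
  simp only [Lagrange.basis, Polynomial.eval_prod, Lagrange.basisDivisor, Polynomial.eval_mul,
    Polynomial.eval_C, Polynomial.eval_sub, Polynomial.eval_X]
  rw [he, prod_mul_distrib, prod_inv_distrib, mul_comm]

section DiffOp

variable (𝕜 : Type*) [RCLike 𝕜] (Z : ℕ → Set.Icc (-1 : ℝ) 1)

theorem interpOp_apply (k : ℕ) (f : C(Set.Icc (-1 : ℝ) 1, 𝕜)) (x : Set.Icc (-1 : ℝ) 1) :
    interpOp 𝕜 Z k f x = ∑ j ∈ range k, f (Z j) *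
      (((Lagrange.basis (range k) (fun i => (Z i : ℝ)) j).eval (x : ℝ) : ℝ) : 𝕜) := by
  simp [interpOp, lagrangeFun, ContinuousMap.sum_apply]

theorem diffOp_apply (k : ℕ) (hZ : ∀ j < k, (Z j : ℝ) ≠ Z k) (f : C(Set.Icc (-1 : ℝ) 1, 𝕜))
    (x : Set.Icc (-1 : ℝ) 1) :
    diffOp 𝕜 Z k f x = ∑ j ∈ range (k + 1), f (Z j) *
      (((∏ i ∈ range k, ((x : ℝ) - Z i)) *
        (∏ i ∈ (range (k + 1)).erase j, ((Z j : ℝ) - Z i))⁻¹ : ℝ) : 𝕜) := by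
  rw [diffOp, _root_.sub_apply, ContinuousMap.sub_apply, interpOp_apply,
    interpOp_apply, sum_range_succ, sum_range_succ, add_sub_right_comm, ← sum_sub_distrib,
    lagrange_basis_succ_self (fun i => (Z i : ℝ))]
  congr 1
  refine sum_congr rfl fun j hj => ?_
  rw [← mul_sub, ← RCLike.ofReal_sub,
    lagrange_basis_succ_sub (fun i => (Z i : ℝ)) (mem_range.1 hj) (hZ j (mem_range.1 hj))]

theorem diffNorm_le (k : ℕ) (hZ : ∀ j < k, (Z j : ℝ) ≠ Z k) {C : ℝ} (hC : 0 ≤ C)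
    (h : ∀ x : Set.Icc (-1 : ℝ) 1, |∏ i ∈ range k, ((x : ℝ) - Z i)| *
      ∑ j ∈ range (k + 1), (∏ i ∈ (range (k + 1)).erase j, |(Z j : ℝ) - Z i|)⁻¹ ≤ C) :
    diffNorm 𝕜 Z k ≤ C := by
  refine ContinuousLinearMap.opNorm_le_bound _ hC fun f => ?_
  rw [ContinuousMap.norm_le _ (by positivity)]
  intro x
  rw [diffOp_apply 𝕜 Z k hZ]
  refine (norm_sum_le _ _).trans (le_trans ?_ (mul_le_mul_of_nonneg_right (h x) (norm_nonneg f)))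
  rw [mul_sum, sum_mul]
  refine sum_le_sum fun j _ => ?_
  rw [norm_mul, RCLike.norm_ofReal, abs_mul, abs_inv, abs_prod (s := (range (k + 1)).erase j),
    mul_comm]
  exact mul_le_mul_of_nonneg_left (f.norm_coe_le_norm _) (by positivity)

theorem diffNorm_zero : diffNorm 𝕜 Z 0 = 1 := by
  refine (diffNorm_le 𝕜 Z 0 (by simp) zero_le_one fun x => by simp).antisymm ?_
  -- Constants attain the norm.
  have h1 : diffOp 𝕜 Z 0 1 = 1 := by
    ext x
    rw [diffOp_apply 𝕜 Z 0 (by simp)]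
    simp
  have h2 := (diffOp 𝕜 Z 0).le_opNorm 1
  have : Nonempty (Set.Icc (-1 : ℝ) 1) := ⟨Z 0⟩
  rwa [h1, norm_one, mul_one] at h2

end DiffOp

/-! ### Bounds for projected Leja sequences -/

theorem IsRLeja.exists_lift {R : ℕ → Set.Icc (-1 : ℝ) 1} (hR : IsRLeja R) :
    ∃ E c : ℕ → ℂ, IsProjectionLift E c ∧ (∀ k, (R k : ℝ) = (c k).re) ∧
      ∀ k, ∀ j < k, (R j : ℝ) ≠ R k := by
  obtain ⟨E, hE, J, hJ0, hJ, hRJ⟩ := hR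
  refine ⟨E, fun k => E (J k), ⟨hE, ?_, ?_, fun n m hm => ?_⟩, hRJ, fun k j hj => ?_⟩
  · rw [hJ0, hE.1]
  · have := (hE.binarySym 1).1 0
    rw [projection_index_one hE hJ0 hJ hRJ]
    simpa [hE.1] using this
  · rw [projection_index hE hJ0 hJ hRJ n m hm]
    rfl
  · rw [hRJ k]
    exact ((hJ k (by omega)).1.2 j hj).symm

theorem IsRLeja.diffNorm_two_pow_add_le (𝕜 : Type*) [RCLike 𝕜] {R : ℕ → Set.Icc (-1 : ℝ) 1}
    (hR : IsRLeja R) {n m : ℕ} (hm : m < 2 ^ n) :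
    diffNorm 𝕜 R (2 ^ n + 1 + m) ≤ 2 * 2 ^ binaryOnes (m + 1) * 2 ^ n := by
  obtain ⟨E, c, h, hc, hinj⟩ := hR.exists_lift
  refine diffNorm_le 𝕜 R _ (hinj _) (by positivity) fun x => ?_
  obtain ⟨z, hz, hzx⟩ := exists_norm_eq_one_re_eq x
  simp_rw [hc, ← hzx]
  rw [abs_prod_mul_sum_eq h.norm_eq_one hz]
  exact h.nodeProd_mul_sum_le hm hz

theorem IsRLeja.diffNorm_one_le (𝕜 : Type*) [RCLike 𝕜] {R : ℕ → Set.Icc (-1 : ℝ) 1}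
    (hR : IsRLeja R) : diffNorm 𝕜 R 1 ≤ 2 := by
  obtain ⟨E, c, h, hc, hinj⟩ := hR.exists_lift
  refine diffNorm_le 𝕜 R _ (hinj _) zero_le_two fun x => ?_
  have e1 : (range 2).erase 0 = {1} := by decide
  have e2 : (range 2).erase 1 = {0} := by decide
  have hx : |(x : ℝ) - 1| ≤ 2 := abs_le.2 ⟨by linarith [x.2.1], by linarith [x.2.2]⟩
  norm_num [sum_range_succ, e1, e2, hc, h.zero, h.one]
  exact hx

theorem corollary4p3 (𝕜 : Type*) [RCLike 𝕜] (R : ℕ → Set.Icc (-1 : ℝ) 1) (hR : IsRLeja R) :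
    diffNorm 𝕜 R 0 = 1 ∧
      ∀ n k : ℕ, 2 ^ n ≤ k → k < 2 ^ (n + 1) →
        diffNorm 𝕜 R k ≤ 2 ^ binaryOnes k * 2 ^ n := by
  refine ⟨diffNorm_zero 𝕜 R, fun n k hk hk' => ?_⟩
  have hpow : ∀ n, binaryOnes (2 ^ n) = 1 := fun n => by
    simpa [binaryOnes_zero] using binaryOnes_two_pow_add n 0 (by positivity)
  -- The estimate covers `2^n+1, …, 2^(n+1)`, so a power of two is the last index of the preceding
  -- range; only `k = 1` escapes.
  rcases hk.eq_or_lt with rfl | hlt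
  · rw [hpow]
    rcases n with _ | n
    · simpa using hR.diffNorm_one_le 𝕜
    · have hpos : 0 < 2 ^ n := by positivity
      have := hR.diffNorm_two_pow_add_le 𝕜 (n := n) (m := 2 ^ n - 1) (by omega)
      rw [show 2 ^ n + 1 + (2 ^ n - 1) = 2 ^ (n + 1) by rw [pow_succ]; omega,
        show 2 ^ n - 1 + 1 = 2 ^ n by omega, hpow] at this
      refine this.trans (le_of_eq ?_)
      ring
  · obtain ⟨m, rfl⟩ := Nat.exists_eq_add_of_lt hlt
    rw [pow_succ] at hk'
    have := hR.diffNorm_two_pow_add_le 𝕜 (n := n) (m := m) (by omega)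
    rw [add_right_comm] at this
    refine this.trans (le_of_eq ?_)
    rw [add_assoc, binaryOnes_two_pow_add n (m + 1) (by omega)]
    ring
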